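/- Let $V$ be a finite totally ordered set and let $\Delta$ be a simplicial complex on $V$: a collection of subsets of $V$ that contains $\emptyset$ and every $\{v\}$ with $v\in V$ and is closed under taking subsets. Call a simplicial complex connected if any two of its vertices are joined by a path of edges of the complex (a complex without vertices counts as connected). A facet is a maximal face; a facet $F$ is a leaf if it is the only facet or if there is a facet $G\neq F$ with $F\cap H\subseteq G$ for every facet $H\ne F$. A subcollection of $\Delta$ is a simplicial complex all of whose facets are facets of $\Delta$. Suppose that $\Delta$ is a simplicial tree, i.e. $\Delta$ is connected and every subcollection of $\Delta$ with at least one nonempty face has a leaf. Let $S=k[x_i : i\in\sigma]$ be a polynomial ring over a field $k$, label every vertex $v$ of $\Delta$ with a monomial $m_v\in S$, and let $I=(m_v : v\in V)$. Label each face $F$ with $m_F=\operatorname{lcm}(m_v : v\in F)$, where $m_\emptyset=1$. Let $\mathcal C(\Delta;S)$ be the complex of free $S$-modules whose term in homological degree $n$ has basis $\{e_F : F\in\Delta,\ |F|=n\}$ and whose differential is $$\partial(e_F)=\sum_{v\in F}(-1)^{|\{u\in F\,:\,u<v\}|}\,\frac{m_F}{m_{F\setminus\{v\}}}\;e_{F\setminus\{v\}}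 .$$ For a monomial $m\in S$ let $\Delta_m=\{F\in\Delta : m_v \text{ divides } m\text{ for all } v\in F\}$ be the subcomplex of $\Delta$ induced on the vertices whose labels divide $m$. Then $\mathcal C(\Delta;S)$ is a free resolution of $S/I$ if and only if $\Delta_m$ is connected for every monomial $m\in S$. -/

import Mathlib

namespace PreAbstractSimplicialComplex

/-! Simplicial complexes are Mathlib's: `faces` is a downward closed set of *nonempty* finite sets
of vertices, and the empty face is adjoined by hand where it is needed (in the chain complex).
The vertices of `K` are the `v` with `{v} ∈ K.faces`. -/

/-- The facets of a simplicial complex: its maximal faces under inclusion. -/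
def facets {V : Type*} (K : PreAbstractSimplicialComplex V) : Set (Finset V) :=
  {F | Maximal (fun G => G ∈ K.faces) F}

/-- `F` is a leaf of `K`: it is a facet and either it is the only facet, or there is another
facet `G` (a joint) that contains the intersection of `F` with every facet other than `F`. -/
def IsLeaf {V : Type*} [DecidableEq V] (K : PreAbstractSimplicialComplex V) (F : Finset V) :
    Prop :=
  F ∈ K.facets ∧
    (K.facets = {F} ∨
      ∃ G ∈ K.facets, G ≠ F ∧ ∀ H ∈ K.facets, H ≠ F → F ∩ H ⊆ G)

/-- `L` is a subcollection of `K`: a simplicial complex all of whose facets are facets of `K`. -/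
def IsSubcollection {V : Type*} (L K : PreAbstractSimplicialComplex V) : Prop :=
  L.facets ⊆ K.facets

/-- The graph formed by the edges (one-dimensional faces) of `K`. -/
def edgeGraph {V : Type*} [DecidableEq V] (K : PreAbstractSimplicialComplex V) :
    SimpleGraph V where
  Adj a b := a ≠ b ∧ {a, b} ∈ K.faces
  symm := ⟨fun a b h => ⟨h.1.symm, Finset.pair_comm a b ▸ h.2⟩⟩
  loopless := ⟨fun _ h => h.1 rfl⟩

/-- `K` is connected: any two vertices of `K` are joined by a path of edges of `K`.
The complex without vertices counts as connected. -/
def IsConnected {V : Type*} [DecidableEq V] (K : PreAbstractSimplicialComplex V) : Prop :=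
  ∀ u v : V, {u} ∈ K.faces → {v} ∈ K.faces → K.edgeGraph.Reachable u v

/-- A (finite) simplicial complex is a simplicial tree if it is connected and every nonempty
subcollection has a leaf. -/
def IsTree {V : Type*} [DecidableEq V] (K : PreAbstractSimplicialComplex V) : Prop :=
  K.IsConnected ∧
    ∀ L : PreAbstractSimplicialComplex V, L.IsSubcollection K → L.faces.Nonempty →
      ∃ F, L.IsLeaf F

/-- The induced subcomplex of `K` on the set `X` of vertices. -/
def induced {V : Type*} (K : PreAbstractSimplicialComplex V) (X : Set V) :
    PreAbstractSimplicialComplex V where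
  faces := {F | F ∈ K.faces ∧ (F : Set V) ⊆ X}
  isRelLowerSet_faces := fun {_} hF =>
    ⟨(K.isRelLowerSet_faces hF.1).1, fun {_} hGF hG =>
      ⟨(K.isRelLowerSet_faces hF.1).2 hGF hG,
        fun _ hx => hF.2 (Finset.mem_coe.2 (hGF (Finset.mem_coe.1 hx)))⟩⟩

/-- For vertex labels `x ^ (label v)`, the subcomplex `Δ_m` of `K` induced on the vertices whose
label divides the monomial `x ^ m`. Monomials are given by their exponent vectors, and divisibility
of monomials is `≤` of exponent vectors (`MvPolynomial.monomial_dvd_monomial`). -/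
def inducedLE {V σ : Type*} (K : PreAbstractSimplicialComplex V) (label : V → σ →₀ ℕ)
    (m : σ →₀ ℕ) : PreAbstractSimplicialComplex V :=
  K.induced {v | label v ≤ m}

/-- The faces of `K` with `n` vertices (dimension `n - 1`), including the empty face for `n = 0`. -/
def Face {V : Type*} (K : PreAbstractSimplicialComplex V) (n : ℕ) : Type _ :=
  {F : Finset V // (F = ∅ ∨ F ∈ K.faces) ∧ F.card = n}

/-- The codimension-one face of `F` opposite to the vertex `v`. -/
def Face.erase {V : Type*} [DecidableEq V] {K : PreAbstractSimplicialComplex V} {n : ℕ}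
    (F : K.Face (n + 1)) (v : V) (hv : v ∈ F.1) : K.Face n :=
  ⟨F.1.erase v, by
    have hF : F.1 ∈ K.faces := by
      rcases F.2.1 with h | h
      · rw [h] at hv
        exact absurd hv (Finset.notMem_empty v)
      · exact h
    rcases (F.1.erase v).eq_empty_or_nonempty with h | h
    · exact Or.inl h
    · exact Or.inr ((K.isRelLowerSet_faces hF).2 (Finset.erase_subset v F.1) h), by
    rw [Finset.card_erase_of_mem hv, F.2.2, Nat.add_sub_cancel]⟩

/-- The label of a face: the least common multiple of the labels of its vertices, that is, the
supremum of their exponent vectors. The empty face has label `1` (exponent vector `0`). -/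
noncomputable def faceLabel {V σ : Type*} (label : V → σ →₀ ℕ) (F : Finset V) : σ →₀ ℕ :=
  F.sup label

/-- The term of `C(K; S)` in homological degree `n`: the free `S`-module, `S = k[x_i : i ∈ σ]`, on
the faces of `K` with `n` vertices. -/
abbrev ChainModule {V : Type*} (k σ : Type*) [CommRing k]
    (K : PreAbstractSimplicialComplex V) (n : ℕ) : Type _ :=
  K.Face n →₀ MvPolynomial σ k

/-- The differential of the (homogenized) simplicial chain complex `C(K; S)` of the labeled complex
`K`:
`e_F ↦ ∑_{v ∈ F} (-1) ^ #{u ∈ F | u < v} (m_F / m_{F ∖ v}) e_{F ∖ v}`,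
where `m_G` is the label of the face `G`. -/
noncomputable def boundary {V σ : Type*} (k : Type*) [CommRing k] [LinearOrder V]
    (K : PreAbstractSimplicialComplex V) (label : V → σ →₀ ℕ) (n : ℕ) :
    K.ChainModule k σ (n + 1) →ₗ[MvPolynomial σ k] K.ChainModule k σ n :=
  Finsupp.linearCombination (MvPolynomial σ k) fun F : K.Face (n + 1) =>
    ∑ v ∈ F.1.attach,
      Finsupp.single (F.erase v.1 v.2)
        (MvPolynomial.monomial (faceLabel label F.1 - faceLabel label (F.1.erase v.1))
          ((-1 : k) ^ (F.1.filter (fun u => u < v.1)).card))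

end PreAbstractSimplicialComplex

/-- The sequence `⋯ → C 2 → C 1 → C 0` of `R`-modules with the maps `d` is a free resolution of the
`R`-module `M`: all terms are free and, for some augmentation `ε : C 0 → M`, the sequence
`⋯ → C 2 → C 1 → C 0 → M → 0` is exact. -/
def IsFreeResolution (R : Type*) [CommRing R] (C : ℕ → Type*) [∀ n, AddCommGroup (C n)]
    [∀ n, Module R (C n)] (d : ∀ n, C (n + 1) →ₗ[R] C n)
    (M : Type*) [AddCommGroup M] [Module R M] : Prop :=
  (∀ n, Module.Free R (C n)) ∧
    (∀ n, Function.Exact (d (n + 1)) (d n)) ∧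
    ∃ ε : C 0 →ₗ[R] M, Function.Exact (d 0) ε ∧ Function.Surjective ε

/-- The ideal of `k[x_i : i ∈ σ]` generated by the vertex labels. -/
noncomputable def labelIdeal {V σ : Type*} (k : Type*) [CommRing k] (label : V → σ →₀ ℕ) :
    Ideal (MvPolynomial σ k) :=
  Ideal.span (Set.range fun v => MvPolynomial.monomial (label v) (1 : k))

/-! The differential preserves multidegree, so over `k` the complex splits into strands. The strand
at a monomial `m` is the augmented simplicial chain complex of `Δ_m`, so exactness in positive
homological degrees means that every `Δ_m` has vanishing reduced homology (`exact_boundary_iff`).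
The cokernel in degree `0` is always `S/I` (`exists_augmentation`).

Reduced `H_0` over a nontrivial ring vanishes exactly for connected complexes
(`exactAt_one_of_isConnected`, `isConnected_of_exactAt_one`). Induced subcomplexes of a tree have no
higher homology (`exactAt_induced_of_isTree`), so connectedness is the only obstruction. For this,
remove a leaf `A` with joint `G`: the part of a cycle that lies in `A` alone has its boundary in `A
∩ G`, and coning from one vertex there moves the cycle, up to a boundary, onto the other facets
(`exists_bd_eq_of_erase`). -/

namespace SimplicialChain

/-! ### Chains on the full simplex: signs, boundary and cones. -/

variable {V k : Type*} [LinearOrder V]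

/-- The incidence sign `(-1) ^ #{u ∈ G | u < v}`. -/
def sign (k : Type*) [CommRing k] (v : V) (G : Finset V) : k :=
  (-1) ^ (G.filter (fun u => u < v)).card

variable [CommRing k]

theorem sign_mul_self (v : V) (G : Finset V) : sign k v G * sign k v G = 1 := by
  unfold sign
  rw [← pow_add, ← two_mul, pow_mul]
  simp

theorem sign_insert_of_lt {u v : V} {G : Finset V} (h : u < v) (hu : u ∉ G) :
    sign k v (insert u G) = -sign k v G := by
  unfold sign
  rw [Finset.filter_insert, if_pos h, Finset.card_insert_of_notMem (by simp [hu]), pow_succ]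
  ring

theorem sign_insert_of_le {u v : V} (G : Finset V) (h : v ≤ u) :
    sign k v (insert u G) = sign k v G := by
  unfold sign
  rw [Finset.filter_insert, if_neg h.not_gt]

theorem sign_erase_self (v : V) (G : Finset V) : sign k v (G.erase v) = sign k v G := by
  by_cases h : v ∈ G
  · conv_rhs => rw [← Finset.insert_erase h, sign_insert_of_le _ le_rfl]
  · rw [Finset.erase_eq_of_notMem h]

theorem sign_mul_sign_insert {u v : V} {G : Finset V} (huv : u ≠ v) (hu : u ∉ G) (hv : v ∉ G) :
    sign k v G * sign k u (insert v G) = -(sign k u G * sign k v (insert u G)) := by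
  rcases lt_or_gt_of_ne huv with h | h
  · rw [sign_insert_of_le G h.le, sign_insert_of_lt h hu]; ring
  · rw [sign_insert_of_le G h.le, sign_insert_of_lt h hv]; ring

/-- The diagonal needs its own hypothesis: antisymmetry gives only `2 • f i i = 0`, which is not
enough in characteristic 2. -/
theorem sum_sum_eq_zero_of_antisymm {ι M : Type*} [Fintype ι] [AddCommGroup M] (f : ι → ι → M)
    (hf : ∀ i j, f i j = -f j i) (h0 : ∀ i, f i i = 0) : ∑ i, ∑ j, f i j = 0 := by
  classical
  rw [← Fintype.sum_prod_type' f]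
  refine Finset.sum_involution (fun p _ => p.swap) (fun p _ => ?_) (fun p _ hp h => hp ?_)
    (fun _ _ => Finset.mem_univ _) (fun p _ => p.swap_swap)
  · rw [hf p.1 p.2]; simp
  · have : p.2 = p.1 := congrArg Prod.fst h
    rw [this, h0]

/-- The cone operator with apex `a`, `e_F ↦ ± e_{F ∪ a}`. -/
def cone (a : V) : (Finset V → k) →ₗ[k] (Finset V → k) where
  toFun c G := if a ∈ G then sign k a G * c (G.erase a) else 0
  map_add' c d := by ext G; by_cases h : a ∈ G <;> simp [h, mul_add]
  map_smul' r c := by ext G; by_cases h : a ∈ G <;> simp [h, mul_left_comm]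

theorem cone_apply_mem {a : V} {G : Finset V} (h : a ∈ G) (c : Finset V → k) :
    cone a c G = sign k a G * c (G.erase a) := if_pos h

theorem cone_apply_notMem {a : V} {G : Finset V} (h : a ∉ G) (c : Finset V → k) :
    cone a c G = 0 := if_neg h

variable [Fintype V]

/-- The boundary operator of the augmented simplicial chain complex of the full simplex on `V`;
a chain is the function of its coefficients. -/
def bd : (Finset V → k) →ₗ[k] (Finset V → k) where
  toFun c G := ∑ v, if v ∈ G then 0 else sign k v G * c (insert v G)
  map_add' c d := by
    ext G
    simp only [Pi.add_apply, ← Finset.sum_add_distrib]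
    refine Finset.sum_congr rfl fun v _ => ?_
    split_ifs <;> simp [mul_add]
  map_smul' r c := by
    ext G
    simp only [Pi.smul_apply, smul_eq_mul, RingHom.id_apply, Finset.mul_sum]
    refine Finset.sum_congr rfl fun v _ => ?_
    split_ifs <;> ring

theorem bd_apply (c : Finset V → k) (G : Finset V) :
    bd c G = ∑ v, if v ∈ G then 0 else sign k v G * c (insert v G) := rfl

theorem exists_of_bd_apply_ne_zero {c : Finset V → k} {G : Finset V} (h : bd c G ≠ 0) :
    ∃ v, v ∉ G ∧ c (insert v G) ≠ 0 := by
  contrapose! h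
  refine Finset.sum_eq_zero fun v _ => ?_
  by_cases hv : v ∈ G
  · simp [hv]
  · simp [h v hv]

theorem bd_bd (c : Finset V → k) : bd (bd c) = 0 := by
  ext G
  have key : bd (bd c) G = ∑ v, ∑ u, if v ∈ G ∨ u ∈ G ∨ u = v then 0 else
      sign k v G * sign k u (insert v G) * c (insert u (insert v G)) := by
    refine Finset.sum_congr rfl fun v _ => ?_
    by_cases hv : v ∈ G
    · simp [hv]
    · rw [if_neg hv, bd_apply, Finset.mul_sum]
      refine Finset.sum_congr rfl fun u _ => ?_
      by_cases hu : u ∈ G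
      · simp [hu]
      by_cases huv : u = v
      · simp [huv]
      · simp [hv, hu, huv, mul_assoc]
  rw [key]
  refine sum_sum_eq_zero_of_antisymm _ (fun v u => ?_) (fun v => by simp)
  by_cases hv : v ∈ G
  · simp [hv]
  by_cases hu : u ∈ G
  · simp [hu]
  by_cases huv : u = v
  · simp [huv]
  · rw [if_neg (by tauto), if_neg (by tauto), Finset.insert_comm u v,
      sign_mul_sign_insert huv hu hv]
    ring

/-- The cone is a contracting homotopy. Any apex and any chain are allowed because the ambient
complex is the full simplex; whether supports stay inside a given subcomplex is checked at each use.
-/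
theorem bd_cone_add_cone_bd (a : V) (c : Finset V → k) : bd (cone a c) + cone a (bd c) = c := by
  ext G
  rw [Pi.add_apply]
  by_cases ha : a ∈ G
  · obtain ⟨B, hB, rfl⟩ : ∃ B, a ∉ B ∧ G = insert a B :=
      ⟨G.erase a, Finset.notMem_erase _ _, (Finset.insert_erase ha).symm⟩
    rw [cone_apply_mem ha, Finset.erase_insert hB, bd_apply, bd_apply, Finset.mul_sum,
      ← Finset.sum_add_distrib, Finset.sum_eq_single a]
    · rw [if_pos ha, if_neg hB, zero_add, ← mul_assoc, sign_insert_of_le _ le_rfl, sign_mul_self,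
        one_mul]
    · intro v _ hva
      by_cases hv : v ∈ B
      · simp [hv]
      · rw [if_neg (by simp [hv, hva]), if_neg hv, cone_apply_mem (by simp),
          Finset.insert_comm v a, Finset.erase_insert (by simp [hB, Ne.symm hva]), ← mul_assoc,
          ← mul_assoc, ← add_mul, Finset.insert_comm a v]
        have h1 : sign k a (insert v (insert a B)) = sign k a (insert v B) := by
          rw [Finset.insert_comm, sign_insert_of_le _ le_rfl]
        rw [h1, sign_insert_of_le B (le_refl a)]
        have h2 : sign k v (insert a B) * sign k a (insert v B) =
            -(sign k a B * sign k v B) := by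
          rcases lt_or_gt_of_ne hva with h | h
          · rw [sign_insert_of_le B h.le, sign_insert_of_lt h hv]; ring
          · rw [sign_insert_of_le B h.le, sign_insert_of_lt h hB]; ring
        rw [h2]; ring
    · simp
  · rw [cone_apply_notMem ha, add_zero, bd_apply, Finset.sum_eq_single a]
    · rw [if_neg ha, cone_apply_mem (by simp), Finset.erase_insert ha,
        sign_insert_of_le _ le_rfl, ← mul_assoc, sign_mul_self, one_mul]
    · intro v _ hva
      by_cases hv : v ∈ G
      · simp [hv]
      · rw [if_neg hv, cone_apply_notMem (by simp [Ne.symm hva, ha]), mul_zero]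
    · simp

/-! ### Removing a leaf. -/

/-- Adding the simplex `A`, whose common faces with the rest lie in one face `G` of the rest,
creates no homology in positive dimensions; all is restricted to a set `X` of vertices. -/
theorem exists_bd_eq_of_erase {X : Set V} {𝓕 : Finset (Finset V)} {A : Finset V}
    (hA : 𝓕 = {A} ∨ ∃ G ∈ 𝓕, G ≠ A ∧ ∀ H ∈ 𝓕, H ≠ A → A ∩ H ⊆ G) {n : ℕ}
    (ih : ∀ c : Finset V → k,
      (∀ F, c F ≠ 0 → F.card = n + 2 ∧ (F : Set V) ⊆ X ∧ ∃ H ∈ 𝓕.erase A, F ⊆ H) → bd c = 0 →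
      ∃ w : Finset V → k, bd w = c ∧
        ∀ F, w F ≠ 0 → F.card = n + 3 ∧ (F : Set V) ⊆ X ∧ ∃ H ∈ 𝓕.erase A, F ⊆ H)
    (c : Finset V → k)
    (hc : ∀ F, c F ≠ 0 → F.card = n + 2 ∧ (F : Set V) ⊆ X ∧ ∃ H ∈ 𝓕, F ⊆ H) (hbd : bd c = 0) :
    ∃ w : Finset V → k, bd w = c ∧
      ∀ F, w F ≠ 0 → F.card = n + 3 ∧ (F : Set V) ⊆ X ∧ ∃ H ∈ 𝓕, F ⊆ H := by
  classical
  -- `c₂` keeps the faces that lie in no member of `𝓕` but `A`; `c₁` keeps all others.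
  set c₁ : Finset V → k := fun F => if ∃ H ∈ 𝓕.erase A, F ⊆ H then c F else 0 with hc₁
  set c₂ : Finset V → k := fun F => if ∃ H ∈ 𝓕.erase A, F ⊆ H then 0 else c F with hc₂
  have hsum : c₁ + c₂ = c := by
    ext F; by_cases h : ∃ H ∈ 𝓕.erase A, F ⊆ H <;> simp only [hc₁, hc₂, Pi.add_apply, h] <;> simp
  have h₁ : ∀ F, c₁ F ≠ 0 →
      F.card = n + 2 ∧ (F : Set V) ⊆ X ∧ ∃ H ∈ 𝓕.erase A, F ⊆ H := by
    intro F hF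
    by_cases h : ∃ H ∈ 𝓕.erase A, F ⊆ H
    · have hF' : c F ≠ 0 := by simpa only [hc₁, if_pos h] using hF
      exact ⟨(hc F hF').1, (hc F hF').2.1, h⟩
    · exact absurd (by simp only [hc₁, if_neg h]) hF
  have h₂ : ∀ F, c₂ F ≠ 0 → F.card = n + 2 ∧ (F : Set V) ⊆ X ∧ F ⊆ A := by
    intro F hF
    by_cases h : ∃ H ∈ 𝓕.erase A, F ⊆ H
    · exact absurd (by simp only [hc₂, if_pos h]) hF
    · have hF' : c F ≠ 0 := by simpa only [hc₂, if_neg h] using hF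
      obtain ⟨hcard, hX, H, hH, hFH⟩ := hc F hF'
      refine ⟨hcard, hX, ?_⟩
      by_cases hHA : H = A
      · exact hHA ▸ hFH
      · exact absurd ⟨H, Finset.mem_erase.2 ⟨hHA, hH⟩, hFH⟩ h
  by_cases hz : c₂ = 0
  · rw [hz, add_zero] at hsum
    obtain ⟨w, hw, hw'⟩ := ih c₁ h₁ (hsum ▸ hbd)
    exact ⟨w, hw.trans hsum, fun F hF => ⟨(hw' F hF).1, (hw' F hF).2.1,
      (hw' F hF).2.2.imp fun H hH => ⟨Finset.mem_of_mem_erase hH.1, hH.2⟩⟩⟩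
  obtain ⟨F₀, hF₀⟩ : ∃ F, c₂ F ≠ 0 := by
    by_contra! h; exact hz (funext h)
  have hA𝓕 : A ∈ 𝓕 := by
    by_contra h
    obtain ⟨H, hH, hFH⟩ := (hc F₀ (fun h' => hF₀ (by simp [hc₂, h']))).2.2
    refine hF₀ (if_pos ⟨H, Finset.mem_erase.2 ⟨?_, hH⟩, hFH⟩)
    rintro rfl; exact h hH
  -- Since `bd c₂ = -bd c₁`, its faces lie in `A` and also in another member of `𝓕`, hence in the
  -- joint.
  have hbd₂ : ∀ B, bd c₂ B ≠ 0 → B.card = n + 1 ∧ (B : Set V) ⊆ X ∧ B ⊆ A ∧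
      ∃ H ∈ 𝓕.erase A, B ⊆ H := by
    intro B hB
    obtain ⟨v, hv, hvB⟩ := exists_of_bd_apply_ne_zero hB
    obtain ⟨hcard, hX, hsub⟩ := h₂ _ hvB
    rw [Finset.card_insert_of_notMem hv] at hcard
    refine ⟨by omega, fun x hx => hX (by simpa using Or.inr hx),
      (Finset.subset_insert _ _).trans hsub, ?_⟩
    have : bd c₁ B ≠ 0 := by
      intro h
      rw [← hsum, map_add] at hbd
      have := congrFun hbd B
      rw [Pi.add_apply, h, zero_add] at this
      exact hB this
    obtain ⟨u, -, huB⟩ := exists_of_bd_apply_ne_zero this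
    exact (h₁ _ huB).2.2.imp fun H hH => ⟨hH.1, (Finset.subset_insert _ _).trans hH.2⟩
  -- The apex is a vertex of some face in the support of `bd c₂`, so it lies in `A`, in the joint
  -- and in `X`. Such a face has `n + 1 > 0` vertices; this is where positive dimension enters. If
  -- `bd c₂ = 0`, any vertex of `F₀` serves.
  obtain ⟨a, haA, haX, ha⟩ : ∃ a, a ∈ A ∧ a ∈ X ∧
      ∀ B, bd c₂ B ≠ 0 → ∃ H ∈ 𝓕.erase A, insert a B ⊆ H := by
    by_cases h : ∃ B, bd c₂ B ≠ 0
    · obtain ⟨B, hB⟩ := h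
      obtain ⟨hcard, hX, hBA, H, hH, hBH⟩ := hbd₂ B hB
      obtain ⟨a, ha⟩ : B.Nonempty := Finset.card_pos.1 (by omega)
      rcases hA with hA | ⟨G, hG, hGA, hAG⟩
      · simp [hA] at hH
      refine ⟨a, hBA ha, hX ha, fun C hC => ⟨G, Finset.mem_erase.2 ⟨hGA, hG⟩, ?_⟩⟩
      have hjoint : ∀ C, bd c₂ C ≠ 0 → C ⊆ G := fun C hC => by
        obtain ⟨-, -, hCA, H', hH', hCH⟩ := hbd₂ C hC
        exact (Finset.subset_inter hCA hCH).trans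
          (hAG H' (Finset.mem_of_mem_erase hH') (Finset.ne_of_mem_erase hH'))
      exact Finset.insert_subset (hjoint B hB ha) (hjoint C hC)
    · obtain ⟨hcard, hX, hsub⟩ := h₂ F₀ hF₀
      obtain ⟨a, ha⟩ : F₀.Nonempty := Finset.card_pos.1 (by omega)
      exact ⟨a, hsub ha, hX ha, fun B hB => absurd ⟨B, hB⟩ h⟩
  have hcone : bd (cone a c₂) + cone a (bd c₂) = c₂ := bd_cone_add_cone_bd a c₂
  -- By `hcone`, this chain differs from `c` by the boundary of `cone a c₂`.
  have hd : ∀ F, (c₁ + cone a (bd c₂)) F ≠ 0 →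
      F.card = n + 2 ∧ (F : Set V) ⊆ X ∧ ∃ H ∈ 𝓕.erase A, F ⊆ H := by
    intro F hF
    by_cases hF₁ : c₁ F = 0
    · rw [Pi.add_apply, hF₁, zero_add] at hF
      by_cases haF : a ∈ F
      · rw [cone_apply_mem haF] at hF
        have hF' := right_ne_zero_of_mul hF
        obtain ⟨hcard, hX, -⟩ := hbd₂ _ hF'
        refine ⟨?_, ?_, by simpa [Finset.insert_erase haF] using ha _ hF'⟩
        · have := Finset.card_erase_add_one haF; omega
        · intro x hx
          by_cases hxa : x = a
          · exact hxa ▸ haX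
          · exact hX (Finset.mem_coe.2 (Finset.mem_erase.2 ⟨hxa, hx⟩))
      · exact absurd (cone_apply_notMem haF _) hF
    · exact h₁ F hF₁
  obtain ⟨w, hw, hw'⟩ := ih (c₁ + cone a (bd c₂)) hd (by
    have h := congrArg bd hcone
    rw [map_add, bd_bd, zero_add] at h
    rw [map_add, h, ← map_add, hsum, hbd])
  refine ⟨w + cone a c₂, ?_, fun F hF => ?_⟩
  · rw [map_add, hw, add_assoc, add_comm (cone a (bd c₂)), hcone, hsum]
  · by_cases hwF : w F = 0
    · rw [Pi.add_apply, hwF, zero_add] at hF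
      by_cases haF : a ∈ F
      · rw [cone_apply_mem haF] at hF
        obtain ⟨hcard, hX, hsub⟩ := h₂ _ (right_ne_zero_of_mul hF)
        refine ⟨?_, ?_, A, hA𝓕, ?_⟩
        · have := Finset.card_erase_add_one haF; omega
        · intro x hx
          by_cases hxa : x = a
          · exact hxa ▸ haX
          · exact hX (Finset.mem_coe.2 (Finset.mem_erase.2 ⟨hxa, hx⟩))
        · rw [← Finset.insert_erase haF]
          exact Finset.insert_subset haA hsub
      · exact absurd (cone_apply_notMem haF _) hF
    · exact ⟨(hw' F hwF).1, (hw' F hwF).2.1,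
        (hw' F hwF).2.2.imp fun H hH => ⟨Finset.mem_of_mem_erase hH.1, hH.2⟩⟩

end SimplicialChain

/-! ### Reduced homology in dimension zero and connectedness. -/

namespace SimplicialChain

variable {V k : Type*} [LinearOrder V] [CommRing k]

/-- The chains supported on the faces of `K` with `n` vertices. -/
def chains (k : Type*) [CommRing k] {V : Type*} (K : PreAbstractSimplicialComplex V) (n : ℕ) :
    Submodule k (Finset V → k) where
  carrier := {c | ∀ F, c F ≠ 0 → F.card = n ∧ F ∈ K.faces}
  zero_mem' F h := absurd rfl h
  add_mem' {c d} hc hd F h := by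
    by_cases hcF : c F = 0
    · exact hd F (by simpa [hcF] using h)
    · exact hc F hcF
  smul_mem' r c hc F h := hc F (right_ne_zero_of_mul (a := r) h)

theorem single_mem_chains {K : PreAbstractSimplicialComplex V} {F : Finset V} (hF : F ∈ K.faces)
    (r : k) : Pi.single F r ∈ chains k K F.card := by
  intro G hG
  by_cases h : G = F
  · exact ⟨h ▸ rfl, h ▸ hF⟩
  · exact absurd (Pi.single_eq_of_ne h _) hG

/-- Vanishing of the reduced homology of `K` at the faces with `n` vertices. -/
def ExactAt (k : Type*) [CommRing k] [Fintype V] (K : PreAbstractSimplicialComplex V) (n : ℕ) :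
    Prop :=
  ∀ c ∈ chains k K n, bd c = 0 → ∃ w ∈ chains k K (n + 1), bd w = c

theorem cone_single_empty (u : V) :
    cone u (Pi.single ∅ 1 : Finset V → k) = Pi.single {u} 1 := by
  ext G
  by_cases hu : u ∈ G
  · rw [cone_apply_mem hu]
    by_cases hG : G = {u}
    · subst hG
      simp [sign, Finset.filter_singleton]
    · rw [Pi.single_eq_of_ne hG, Pi.single_eq_of_ne, mul_zero]
      intro h
      rcases Finset.erase_eq_empty_iff _ _ |>.1 h with h | h
      · simp [h] at hu
      · exact hG h
  · rw [cone_apply_notMem hu, Pi.single_eq_of_ne]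
    rintro rfl
    simp at hu

theorem cone_single_mem_chains {K : PreAbstractSimplicialComplex V} {u x : V} (hux : u ≠ x)
    (h : {u, x} ∈ K.faces) : cone u (Pi.single {x} 1 : Finset V → k) ∈ chains k K 2 := by
  intro F hF
  by_cases hu : u ∈ F
  · rw [cone_apply_mem hu] at hF
    have hE : F.erase u = {x} := by
      by_contra hne
      exact right_ne_zero_of_mul hF (Pi.single_eq_of_ne hne _)
    rw [← Finset.insert_erase hu, hE]
    exact ⟨Finset.card_pair hux, h⟩
  · exact absurd (cone_apply_notMem hu _) hF

variable [Fintype V]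

theorem bd_single_singleton (x : V) :
    bd (Pi.single {x} 1 : Finset V → k) = Pi.single ∅ 1 := by
  ext G
  rw [bd_apply]
  by_cases hG : G = ∅
  · subst hG
    rw [Finset.sum_eq_single x]
    · simp [sign]
    · intro v _ hv
      simp [hv]
    · simp
  · rw [Pi.single_eq_of_ne hG]
    refine Finset.sum_eq_zero fun v _ => ?_
    by_cases hv : v ∈ G
    · simp [hv]
    · rw [if_neg hv, Pi.single_eq_of_ne, mul_zero]
      intro h
      obtain ⟨y, hy⟩ := Finset.nonempty_iff_ne_empty.2 hG
      have h1 : y = x := by simpa [h] using Finset.mem_insert_of_mem (a := y) (b := v) hy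
      have h2 : v = x := by simpa [h] using Finset.mem_insert_self v G
      exact hv (h2 ▸ h1 ▸ hy)

/-- An edge `ux` of the path is the cone from `u` over `x`, with boundary `e_x - e_u`; these
telescope. -/
theorem exists_bd_eq_of_reachable {K : PreAbstractSimplicialComplex V} {u v : V}
    (h : K.edgeGraph.Reachable u v) :
    ∃ w ∈ chains k K 2, bd w = Pi.single {v} 1 - Pi.single {u} 1 := by
  obtain ⟨p⟩ := h
  induction p with
  | nil => exact ⟨0, zero_mem _, by simp⟩
  | @cons u x v h p ih =>
    obtain ⟨w, hw, hbd⟩ := ih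
    refine ⟨w + cone u (Pi.single {x} 1), add_mem hw (cone_single_mem_chains h.1 h.2), ?_⟩
    have := bd_cone_add_cone_bd u (Pi.single {x} 1 : Finset V → k)
    rw [bd_single_singleton, cone_single_empty] at this
    rw [map_add, hbd, eq_sub_of_add_eq this]
    abel

theorem bd_apply_empty (c : Finset V → k) : bd c ∅ = ∑ v, c {v} := by
  simp [bd_apply, sign]

theorem eq_sum_single_of_mem_chains_one {K : PreAbstractSimplicialComplex V} {c : Finset V → k}
    (hc : c ∈ chains k K 1) : c = ∑ v, c {v} • (Pi.single {v} 1 : Finset V → k) := by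
  ext F
  simp only [Finset.sum_apply, Pi.smul_apply, smul_eq_mul]
  by_cases hF : c F = 0
  · rw [hF, Finset.sum_eq_zero]
    intro v _
    by_cases h : F = {v}
    · simp [← h, hF]
    · rw [Pi.single_eq_of_ne h, mul_zero]
  · obtain ⟨x, rfl⟩ := Finset.card_eq_one.1 (hc F hF).1
    rw [Finset.sum_eq_single x]
    · simp
    · intro v _ hv
      rw [Pi.single_eq_of_ne, mul_zero]
      simpa using hv.symm
    · simp

/-- The coefficients of a cycle sum to zero, so it is a combination of differences `e_v - e_x` with
a fixed vertex `x`. -/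
theorem exactAt_one_of_isConnected {K : PreAbstractSimplicialComplex V} (hK : K.IsConnected) :
    ExactAt k K 1 := by
  intro c hc hbd
  by_cases hz : c = 0
  · exact ⟨0, zero_mem _, by simp [hz]⟩
  obtain ⟨F₀, hF₀⟩ : ∃ F, c F ≠ 0 := by
    by_contra! h; exact hz (funext h)
  obtain ⟨x, rfl⟩ := Finset.card_eq_one.1 (hc F₀ hF₀).1
  have hW : ∀ v, ∃ w ∈ chains k K 2,
      bd w = c {v} • (Pi.single {v} 1 - Pi.single {x} 1 : Finset V → k) := by
    intro v
    by_cases hv : c {v} = 0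
    · exact ⟨0, zero_mem _, by simp [hv]⟩
    · obtain ⟨w, hw, hbdw⟩ :=
        exists_bd_eq_of_reachable (k := k) (hK x v (hc _ hF₀).2 (hc _ hv).2)
      exact ⟨c {v} • w, Submodule.smul_mem _ _ hw, by rw [map_smul, hbdw]⟩
  choose W hW hbdW using hW
  refine ⟨∑ v, W v, sum_mem fun v _ => hW v, ?_⟩
  have h0 : ∑ v, c {v} = 0 := by rw [← bd_apply_empty, hbd]; rfl
  simp only [map_sum, hbdW, smul_sub, Finset.sum_sub_distrib, ← Finset.sum_smul, h0, zero_smul,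
    sub_zero]
  exact (eq_sum_single_of_mem_chains_one hc).symm

/-- Summing the coefficients of `bd w` over the vertices reachable from `u` gives zero, as an edge
has both ends or neither there and its two contributions cancel. For `e_v - e_u` with `v`
unreachable the sum is `-1`. -/
theorem isConnected_of_exactAt_one [Nontrivial k] {K : PreAbstractSimplicialComplex V}
    (hK : ExactAt k K 1) : K.IsConnected := by
  classical
  intro u v hu hv
  obtain ⟨w, hw, hbd⟩ := hK (Pi.single {v} 1 - Pi.single {u} 1)
    (sub_mem (single_mem_chains hv 1) (single_mem_chains hu 1))
    (by rw [map_sub, bd_single_singleton, bd_single_singleton, sub_self])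
  by_contra hne
  have huv : v ≠ u := by
    rintro rfl; exact hne (SimpleGraph.Reachable.refl _)
  have hsum : ∑ x, (if K.edgeGraph.Reachable u x then bd w {x} else 0) = 0 := by
    have key : ∀ x, (if K.edgeGraph.Reachable u x then bd w {x} else 0) =
        ∑ y, if K.edgeGraph.Reachable u x ∧ y ≠ x then sign k y {x} * w {y, x} else 0 := by
      intro x
      by_cases hx : K.edgeGraph.Reachable u x
      · simp only [hx, if_true, true_and, bd_apply, Finset.mem_singleton, ne_eq, ite_not]
      · simp [hx]
    rw [Finset.sum_congr rfl fun x _ => key x]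
    refine sum_sum_eq_zero_of_antisymm _ (fun x y => ?_) (fun x => by simp)
    by_cases hxy : y = x
    · simp [hxy]
    by_cases hz : w {y, x} = 0
    · simp [hz, Finset.pair_comm x y]
    · have hadj : K.edgeGraph.Adj y x := ⟨hxy, (hw _ hz).2⟩
      have hr : K.edgeGraph.Reachable u x ↔ K.edgeGraph.Reachable u y :=
        ⟨fun h => h.trans hadj.symm.reachable, fun h => h.trans hadj.reachable⟩
      by_cases hx : K.edgeGraph.Reachable u x
      · rw [if_pos ⟨hx, hxy⟩, if_pos ⟨hr.1 hx, Ne.symm hxy⟩, Finset.pair_comm x y]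
        have := sign_mul_sign_insert (k := k) hxy (Finset.notMem_empty y) (Finset.notMem_empty x)
        have h1 : ∀ z : V, sign k z ∅ = 1 := fun z => by simp [sign]
        rw [h1, h1, one_mul, one_mul] at this
        simp only [insert_empty_eq] at this
        rw [this, neg_mul]
      · simp [hx, mt hr.2 hx]
  rw [Finset.sum_eq_single u] at hsum
  · simp [hbd, huv.symm] at hsum
  · intro x _ hx
    split_ifs with h
    · have hxv : x ≠ v := by rintro rfl; exact hne h
      simp [hbd, hx, hxv]
    · rfl
  · simp

end SimplicialChain

/-! ### Subcollections given by sets of facets. -/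

namespace PreAbstractSimplicialComplex

variable {V : Type*}

/-- The complex generated by a family of faces. -/
def generatedBy (𝓕 : Finset (Finset V)) : PreAbstractSimplicialComplex V where
  faces := {F | F.Nonempty ∧ ∃ H ∈ 𝓕, F ⊆ H}
  isRelLowerSet_faces := fun {_} hF =>
    ⟨hF.1, fun {_} hGF hG => ⟨hG, hF.2.imp fun _ hH => ⟨hH.1, hGF.trans hH.2⟩⟩⟩

/-- Facets of `K` are pairwise incomparable, so none is absorbed by another. Thus every set of
facets yields a subcollection, to which the leaf condition applies. -/
theorem facets_generatedBy {K : PreAbstractSimplicialComplex V} {𝓕 : Finset (Finset V)}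
    (h𝓕 : (𝓕 : Set (Finset V)) ⊆ K.facets) : (generatedBy 𝓕).facets = 𝓕 := by
  have hne : ∀ H ∈ 𝓕, H ∈ (generatedBy 𝓕).faces := fun H hH =>
    ⟨(K.isRelLowerSet_faces (h𝓕 hH).prop).1, H, hH, subset_rfl⟩
  ext F
  constructor
  · intro hF
    obtain ⟨-, H, hH, hFH⟩ := hF.prop
    exact (hF.eq_of_le (hne H hH) hFH) ▸ hH
  · intro hF
    refine ⟨hne F hF, fun G hG hFG => ?_⟩
    obtain ⟨-, H, hH, hGH⟩ := hG
    exact hGH.trans ((h𝓕 hF).eq_of_le (h𝓕 hH).prop (hFG.trans hGH)).ge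

theorem exists_facet_superset [Finite V] {K : PreAbstractSimplicialComplex V} {F : Finset V}
    (hF : F ∈ K.faces) : ∃ H ∈ K.facets, F ⊆ H := by
  obtain ⟨H, hFH, hH⟩ := (Set.toFinite K.faces).exists_le_maximal hF
  exact ⟨H, hH, hFH⟩

end PreAbstractSimplicialComplex

/-! ### Acyclicity of induced subcomplexes of a tree in positive dimensions. -/

namespace SimplicialChain

variable {V k : Type*} [LinearOrder V] [CommRing k] [Fintype V]

/-- The induction removes facets of `K` itself and keeps `X` as a constraint on supports, so no
leaves of the induced subcomplex are needed. -/
theorem exists_bd_eq_of_facets {K : PreAbstractSimplicialComplex V} (hK : K.IsTree) (X : Set V)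
    (n : ℕ) (𝓕 : Finset (Finset V)) (h𝓕 : (𝓕 : Set (Finset V)) ⊆ K.facets) (c : Finset V → k)
    (hc : ∀ F, c F ≠ 0 → F.card = n + 2 ∧ (F : Set V) ⊆ X ∧ ∃ H ∈ 𝓕, F ⊆ H) (hbd : bd c = 0) :
    ∃ w : Finset V → k, bd w = c ∧
      ∀ F, w F ≠ 0 → F.card = n + 3 ∧ (F : Set V) ⊆ X ∧ ∃ H ∈ 𝓕, F ⊆ H := by
  induction 𝓕 using Finset.strongInduction generalizing c with
  | H 𝓕 ih =>
    rcases 𝓕.eq_empty_or_nonempty with rfl | ⟨H₀, hH₀⟩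
    · refine ⟨0, ?_, fun F hF => absurd rfl hF⟩
      rw [map_zero]
      ext F
      by_contra h
      obtain ⟨H, hH, -⟩ := (hc F (Ne.symm h)).2.2
      simp at hH
    · have hfacets := PreAbstractSimplicialComplex.facets_generatedBy h𝓕
      obtain ⟨A, hA, hleaf⟩ := hK.2 (PreAbstractSimplicialComplex.generatedBy 𝓕)
        (hfacets.trans_subset h𝓕)
        ⟨H₀, (K.isRelLowerSet_faces (h𝓕 hH₀).prop).1, H₀, hH₀, subset_rfl⟩
      rw [hfacets] at hA hleaf
      refine exists_bd_eq_of_erase (A := A) ?_ (fun c hc hbd => ih _ (Finset.erase_ssubset hA)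
        ((Finset.coe_subset.2 (Finset.erase_subset A 𝓕)).trans h𝓕) c hc hbd) c hc hbd
      exact hleaf.imp_left fun h => by exact_mod_cast h

theorem exactAt_induced_of_isTree {K : PreAbstractSimplicialComplex V} (hK : K.IsTree)
    (X : Set V) (n : ℕ) : ExactAt k (K.induced X) (n + 2) := by
  classical
  intro c hc hbd
  obtain ⟨w, hw, hw'⟩ := exists_bd_eq_of_facets hK X n (Set.toFinite K.facets).toFinset
    (by simp) c (fun F hF => by
      obtain ⟨hcard, hFK, hX⟩ := hc F hF
      obtain ⟨H, hH, hFH⟩ := PreAbstractSimplicialComplex.exists_facet_superset hFK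
      exact ⟨hcard, hX, H, by simpa using hH, hFH⟩) hbd
  refine ⟨w, fun F hF => ?_, hw⟩
  obtain ⟨hcard, hX, H, hH, hFH⟩ := hw' F hF
  have hH' : H ∈ K.facets := by simpa using hH
  exact ⟨hcard, (K.isRelLowerSet_faces hH'.prop).2 hFH (Finset.card_pos.1 (by omega)), hX⟩

end SimplicialChain

namespace PreAbstractSimplicialComplex

theorem Face.erase_val {V : Type*} [DecidableEq V] {K : PreAbstractSimplicialComplex V} {n : ℕ}
    (F : K.Face (n + 1)) (v : V) (hv : v ∈ F.1) : (F.erase v hv).1 = F.1.erase v := rfl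

end PreAbstractSimplicialComplex

/-! ### Multigraded strands of the labeled complex. -/

namespace SimplicialChain

open PreAbstractSimplicialComplex

variable {V k σ : Type*} [Field k]

/-- The component of a chain in the multidegree `m`. -/
noncomputable def strand (label : V → σ →₀ ℕ) (m : σ →₀ ℕ) (p : Finset V → MvPolynomial σ k) :
    Finset V → k := fun F =>
  open Classical in if F.sup label ≤ m then (p F).coeff (m - F.sup label) else 0

/-- The chain of multidegree `m` with the given coefficients. -/
noncomputable def lift (label : V → σ →₀ ℕ) (m : σ →₀ ℕ) (c : Finset V → k) :
    Finset V → MvPolynomial σ k := fun F => MvPolynomial.monomial (m - F.sup label) (c F)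

theorem coeff_eq_strand (label : V → σ →₀ ℕ) (p : Finset V → MvPolynomial σ k) (F : Finset V)
    (u : σ →₀ ℕ) : (p F).coeff u = strand label (u + F.sup label) p F := by
  simp [strand]

theorem strand_lift {label : V → σ →₀ ℕ} {m : σ →₀ ℕ} {c : Finset V → k}
    (hc : ∀ F, c F ≠ 0 → F.sup label ≤ m) : strand label m (lift label m c) = c := by
  classical
  ext F
  rw [strand]
  split_ifs with h
  · rw [lift, MvPolynomial.coeff_monomial, if_pos rfl]
  · by_contra h'
    exact h (hc F (Ne.symm h'))

theorem sup_le_of_mem_chains {K : PreAbstractSimplicialComplex V} {label : V → σ →₀ ℕ}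
    {m : σ →₀ ℕ} {n : ℕ} {c : Finset V → k} (hc : c ∈ chains k (K.inducedLE label m) n)
    (F : Finset V) (hF : c F ≠ 0) : F.sup label ≤ m :=
  Finset.sup_le fun _ hv => (hc F hF).2.2 hv

theorem exists_eq_sum_lift_strand [Fintype V] (label : V → σ →₀ ℕ)
    (p : Finset V → MvPolynomial σ k) :
    ∃ M : Finset (σ →₀ ℕ), p = ∑ m ∈ M, lift label m (strand label m p) := by
  classical
  -- The term `x ^ u` at `e_F` has multidegree `u + m_F`; these are all the multidegrees that occur.
  refine ⟨Finset.univ.biUnion fun F => (p F).support.image (· + F.sup label), ?_⟩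
  ext F u
  rw [Finset.sum_apply, MvPolynomial.coeff_sum, Finset.sum_eq_single (u + F.sup label)]
  · simp [lift, coeff_eq_strand label p F u]
  · intro m _ hm
    rw [lift, MvPolynomial.coeff_monomial, strand]
    split_ifs with h1 h2
    · exact absurd (by rw [← h1, tsub_add_cancel_of_le h2]) hm
    · rfl
    · rfl
  · intro hm
    rw [lift, MvPolynomial.coeff_monomial, add_tsub_cancel_right, if_pos rfl, ← coeff_eq_strand]
    by_contra h
    exact hm (Finset.mem_biUnion.2 ⟨F, Finset.mem_univ _,
      Finset.mem_image_of_mem _ (MvPolynomial.mem_support_iff.2 h)⟩)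

variable [LinearOrder V]

/-- Extension by zero of a chain on the `n`-element faces of `K` to all finite sets of vertices. -/
noncomputable def extend (K : PreAbstractSimplicialComplex V) (n : ℕ) :
    K.ChainModule k σ n →ₗ[MvPolynomial σ k] (Finset V → MvPolynomial σ k) :=
  Finsupp.lift (Finset V → MvPolynomial σ k) (MvPolynomial σ k) (K.Face n) fun F => Pi.single F.1 1

theorem extend_single {K : PreAbstractSimplicialComplex V} {n : ℕ} (F : K.Face n)
    (p : MvPolynomial σ k) : extend K n (Finsupp.single F p) = Pi.single F.1 p := by
  simp [extend, ← Pi.single_smul]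

theorem extend_apply_face {K : PreAbstractSimplicialComplex V} {n : ℕ} (z : K.ChainModule k σ n)
    (F : K.Face n) : extend K n z F.1 = z F := by
  induction z using Finsupp.induction_linear with
  | zero => simp
  | add x y hx hy => simp [hx, hy]
  | single G p =>
    rw [extend_single]
    by_cases h : F = G
    · simp [h]
    · rw [Pi.single_eq_of_ne (fun h' => h (Subtype.ext h')), Finsupp.single_eq_of_ne h]

theorem extend_apply_of_not {K : PreAbstractSimplicialComplex V} {n : ℕ}
    (z : K.ChainModule k σ n) {F : Finset V} (hF : ¬((F = ∅ ∨ F ∈ K.faces) ∧ F.card = n)) :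
    extend K n z F = 0 := by
  induction z using Finsupp.induction_linear with
  | zero => simp
  | add x y hx hy => simp [hx, hy]
  | single G p =>
    rw [extend_single, Pi.single_eq_of_ne]
    rintro rfl
    exact hF G.2

theorem extend_injective (K : PreAbstractSimplicialComplex V) (n : ℕ) :
    Function.Injective (extend (k := k) (σ := σ) K n) := fun z y h =>
  Finsupp.ext fun F => by rw [← extend_apply_face, h, extend_apply_face]

theorem exists_extend_eq [Finite V] {K : PreAbstractSimplicialComplex V} {n : ℕ}
    {p : Finset V → MvPolynomial σ k}
    (hp : ∀ F, p F ≠ 0 → (F = ∅ ∨ F ∈ K.faces) ∧ F.card = n) : ∃ z, extend K n z = p := by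
  have : Finite (K.Face n) := Subtype.finite
  refine ⟨Finsupp.equivFunOnFinite.symm fun F => p F.1, ?_⟩
  ext1 F
  by_cases hF : (F = ∅ ∨ F ∈ K.faces) ∧ F.card = n
  · exact extend_apply_face _ ⟨F, hF⟩
  · rw [extend_apply_of_not _ hF]
    by_contra h
    exact hF (hp F (Ne.symm h))

/-- The degree `n + 1` rules out the empty face, which is not in `faces`. -/
theorem strand_extend_mem_chains {K : PreAbstractSimplicialComplex V} (label : V → σ →₀ ℕ)
    (m : σ →₀ ℕ) {n : ℕ} (z : K.ChainModule k σ (n + 1)) :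
    strand label m (extend K (n + 1) z) ∈ chains k (K.inducedLE label m) (n + 1) := by
  intro F hF
  rw [strand] at hF
  split_ifs at hF with h
  · by_cases hK : (F = ∅ ∨ F ∈ K.faces) ∧ F.card = n + 1
    · refine ⟨hK.2, hK.1.resolve_left ?_, fun v hv => (Finset.le_sup hv).trans h⟩
      rintro rfl
      simp at hK
    · simp [extend_apply_of_not z hK] at hF
  · exact absurd rfl hF

variable [Fintype V]

/-- The homogenized boundary operator of the full simplex on `V`, a chain being the function of its
coefficients. -/
noncomputable def labeledBd (k : Type*) [Field k] (label : V → σ →₀ ℕ) :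
    (Finset V → MvPolynomial σ k) →ₗ[MvPolynomial σ k] (Finset V → MvPolynomial σ k) where
  toFun p G := ∑ v, if v ∈ G then 0 else
    MvPolynomial.monomial ((insert v G).sup label - G.sup label) (sign k v G) * p (insert v G)
  map_add' c d := by
    ext1 G
    simp only [Pi.add_apply, ← Finset.sum_add_distrib]
    refine Finset.sum_congr rfl fun v _ => ?_
    split_ifs <;> simp [mul_add]
  map_smul' r c := by
    ext1 G
    simp only [Pi.smul_apply, smul_eq_mul, RingHom.id_apply, Finset.mul_sum]
    refine Finset.sum_congr rfl fun v _ => ?_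
    split_ifs <;> ring

theorem labeledBd_apply (label : V → σ →₀ ℕ) (p : Finset V → MvPolynomial σ k) (G : Finset V) :
    labeledBd k label p G = ∑ v, if v ∈ G then 0 else
      MvPolynomial.monomial ((insert v G).sup label - G.sup label) (sign k v G) *
        p (insert v G) := rfl

/-- The same matrix read two ways: `boundary` deletes vertices from the source face, `labeledBd`
adds vertices to the target face. -/
theorem extend_boundary (K : PreAbstractSimplicialComplex V) (label : V → σ →₀ ℕ) (n : ℕ)
    (z : K.ChainModule k σ (n + 1)) :
    extend K n (K.boundary k label n z) = labeledBd k label (extend K (n + 1) z) := by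
  induction z using Finsupp.induction_linear with
  | zero => simp
  | add x y hx hy => simp [hx, hy]
  | single F p =>
    rw [boundary, Finsupp.linearCombination_single, map_smul, map_sum, extend_single]
    ext1 G
    simp only [extend_single, Pi.smul_apply, Finset.sum_apply, labeledBd_apply, smul_eq_mul,
      Finset.mul_sum, Face.erase_val]
    rw [Finset.sum_attach F.1 fun v => p * (Pi.single (F.1.erase v)
      (MvPolynomial.monomial (faceLabel label F.1 - faceLabel label (F.1.erase v))
        ((-1 : k) ^ (F.1.filter (fun u => u < v)).card)) : Finset V → MvPolynomial σ k) G,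
      ← Finset.sum_subset (Finset.subset_univ F.1)]
    · refine Finset.sum_congr rfl fun v hv => ?_
      by_cases hG : G = F.1.erase v
      · subst hG
        rw [if_neg (Finset.notMem_erase v F.1), Finset.insert_erase hv, Pi.single_eq_same,
          Pi.single_eq_same, sign_erase_self, mul_comm]
        rfl
      · rw [Pi.single_eq_of_ne hG, mul_zero]
        by_cases hvG : v ∈ G
        · rw [if_pos hvG]
        · rw [if_neg hvG, Pi.single_eq_of_ne, mul_zero]
          intro h
          exact hG (by rw [← h, Finset.erase_insert hvG])
    · intro v _ hv
      by_cases hvG : v ∈ G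
      · rw [if_pos hvG]
      · rw [if_neg hvG, Pi.single_eq_of_ne, mul_zero]
        intro h
        exact hv (h ▸ Finset.mem_insert_self v G)

/-- The factor `m_{G ∪ v} / m_G` exactly offsets the change of face label, so the multidegree is
kept. Faces whose label does not divide `m` contribute nothing. -/
theorem strand_labeledBd (label : V → σ →₀ ℕ) (m : σ →₀ ℕ) (p : Finset V → MvPolynomial σ k) :
    strand label m (labeledBd k label p) = bd (strand label m p) := by
  classical
  ext G
  rw [bd_apply, strand]
  split_ifs with hG
  · rw [labeledBd_apply, MvPolynomial.coeff_sum]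
    refine Finset.sum_congr rfl fun v _ => ?_
    by_cases hv : v ∈ G
    · simp [hv]
    have hle : G.sup label ≤ (insert v G).sup label := Finset.sup_mono (Finset.subset_insert v G)
    rw [if_neg hv, if_neg hv, MvPolynomial.coeff_monomial_mul', strand]
    by_cases h : (insert v G).sup label ≤ m
    · rw [if_pos h, if_pos (tsub_le_tsub_right h _), tsub_tsub_tsub_cancel_right hle]
    · rw [if_neg h, if_neg, mul_zero]
      intro h'
      rw [tsub_le_tsub_iff_right hG] at h'
      exact h h'
  · refine (Finset.sum_eq_zero fun v _ => ?_).symm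
    split_ifs
    · rfl
    · rw [strand, if_neg fun h => hG ((Finset.sup_mono (Finset.subset_insert v G)).trans h),
        mul_zero]

/-- The hypothesis keeps the truncated subtraction `m - F.sup label` a true difference wherever `c`
is nonzero. -/
theorem labeledBd_lift {label : V → σ →₀ ℕ} {m : σ →₀ ℕ} {c : Finset V → k}
    (hc : ∀ F, c F ≠ 0 → F.sup label ≤ m) :
    labeledBd k label (lift label m c) = lift label m (bd c) := by
  ext1 G
  rw [labeledBd_apply, lift, bd_apply, map_sum]
  refine Finset.sum_congr rfl fun v _ => ?_
  by_cases hv : v ∈ G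
  · simp [hv]
  rw [if_neg hv, if_neg hv, lift, MvPolynomial.monomial_mul]
  by_cases h : c (insert v G) = 0
  · simp [h]
  · rw [add_comm, tsub_add_tsub_cancel (hc _ h) (Finset.sup_mono (Finset.subset_insert v G))]

theorem labeledBd_labeledBd (label : V → σ →₀ ℕ) (p : Finset V → MvPolynomial σ k) :
    labeledBd k label (labeledBd k label p) = 0 := by
  ext F u
  rw [coeff_eq_strand label, strand_labeledBd, strand_labeledBd, bd_bd]
  simp

theorem exists_extend_eq_lift {K : PreAbstractSimplicialComplex V} {label : V → σ →₀ ℕ}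
    {m : σ →₀ ℕ} {n : ℕ} {c : Finset V → k} (hc : c ∈ chains k (K.inducedLE label m) n) :
    ∃ z, extend K n z = lift label m c := by
  refine exists_extend_eq fun F hF => ?_
  have hF' : c F ≠ 0 := by
    rintro h; exact hF (by simp [lift, h])
  exact ⟨Or.inr (hc F hF').2.1, (hc F hF').1⟩

/-- Forward, a cycle of `Δ_m` is lifted to multidegree `m`, and the strand at `m` of a preimage
bounds it. Backward, the finitely many strands of a cycle are bounded separately and the lifts are
added. -/
theorem exact_boundary_iff (K : PreAbstractSimplicialComplex V) (label : V → σ →₀ ℕ) (n : ℕ) :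
    Function.Exact (K.boundary k label (n + 1)) (K.boundary k label n) ↔
      ∀ m, ExactAt k (K.inducedLE label m) (n + 1) := by
  constructor
  · intro h m c hc hbd
    obtain ⟨z, hz⟩ := exists_extend_eq_lift hc
    obtain ⟨y, rfl⟩ := (h z).1 (extend_injective K n (by
      rw [extend_boundary, hz, labeledBd_lift (sup_le_of_mem_chains hc), hbd, map_zero]
      ext1 F
      simp [lift]))
    refine ⟨_, strand_extend_mem_chains label m y, ?_⟩
    rw [← strand_labeledBd, ← extend_boundary, hz, strand_lift (sup_le_of_mem_chains hc)]
  · intro h z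
    constructor
    · intro hz
      have hcycle : labeledBd k label (extend K (n + 1) z) = 0 := by
        rw [← extend_boundary, hz, map_zero]
      have hw : ∀ m, ∃ w ∈ chains k (K.inducedLE label m) (n + 1 + 1),
          bd w = strand label m (extend K (n + 1) z) := fun m =>
        h m _ (strand_extend_mem_chains label m z) (by
          rw [← strand_labeledBd, hcycle]
          ext F
          simp [strand])
      choose w hw hbdw using hw
      choose y hy using fun m => exists_extend_eq_lift (hw m)
      obtain ⟨M, hM⟩ := exists_eq_sum_lift_strand label (extend K (n + 1) z)
      refine ⟨∑ m ∈ M, y m, extend_injective K (n + 1) ?_⟩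
      rw [extend_boundary, map_sum, map_sum, hM]
      refine Finset.sum_congr rfl fun m _ => ?_
      rw [hy, labeledBd_lift (sup_le_of_mem_chains (hw m)), hbdw]
    · rintro ⟨y, rfl⟩
      refine extend_injective K n ?_
      rw [extend_boundary, extend_boundary, labeledBd_labeledBd, map_zero]

/-! ### The augmentation onto `S/I`. -/

theorem boundary_zero_apply (K : PreAbstractSimplicialComplex V) (label : V → σ →₀ ℕ)
    (y : K.ChainModule k σ 1) (E : K.Face 0) :
    K.boundary k label 0 y E =
      ∑ v, extend K 1 y {v} * MvPolynomial.monomial (label v) (1 : k) := by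
  have hE : E.1 = ∅ := Finset.card_eq_zero.1 E.2.2
  rw [← extend_apply_face, extend_boundary, hE, labeledBd_apply]
  simp [sign, mul_comm, bot_eq_zero]

theorem exists_augmentation (Δ : AbstractSimplicialComplex V) (label : V → σ →₀ ℕ) :
    ∃ ε : Δ.toPreAbstractSimplicialComplex.ChainModule k σ 0 →ₗ[MvPolynomial σ k]
        MvPolynomial σ k ⧸ labelIdeal k label,
      Function.Exact (Δ.toPreAbstractSimplicialComplex.boundary k label 0) ε ∧
        Function.Surjective ε := by
  let E : Δ.toPreAbstractSimplicialComplex.Face 0 := ⟨∅, Or.inl rfl, rfl⟩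
  have hE : ∀ F : Δ.toPreAbstractSimplicialComplex.Face 0, F = E := fun F =>
    Subtype.ext (Finset.card_eq_zero.1 F.2.2)
  -- `E` is the only face without vertices, so the degree `0` term is `S`. Since `m_∅ = 1`, the
  -- boundary sends `e_v` to `m_v`, and its image is the ideal of labels.
  refine ⟨(labelIdeal k label).mkQ ∘ₗ Finsupp.lapply E, fun z => ?_, fun x => ?_⟩
  · rw [LinearMap.comp_apply, Finsupp.lapply_apply, Submodule.mkQ_apply,
      Submodule.Quotient.mk_eq_zero, labelIdeal, Ideal.mem_span_range_iff_exists_fun]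
    constructor
    · rintro ⟨c, hc⟩
      obtain ⟨y, hy⟩ := exists_extend_eq (K := Δ.toPreAbstractSimplicialComplex) (n := 1)
        (p := ∑ v, Pi.single {v} (c v)) (fun F hF => by
          rw [Finset.sum_apply] at hF
          obtain ⟨v, -, hv⟩ := Finset.exists_ne_zero_of_sum_ne_zero hF
          have hFv : F = {v} := by
            by_contra h
            exact hv (Pi.single_eq_of_ne h _)
          exact hFv ▸ ⟨Or.inr (Δ.singleton_mem v), Finset.card_singleton v⟩)
      refine ⟨y, Finsupp.ext fun F => ?_⟩
      rw [hE F, boundary_zero_apply, ← hc, hy]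
      refine Finset.sum_congr rfl fun v _ => ?_
      rw [Finset.sum_apply, Finset.sum_eq_single v]
      · rw [Pi.single_eq_same]
      · intro u _ hu
        exact Pi.single_eq_of_ne (by simpa using hu.symm) _
      · simp
    · rintro ⟨y, rfl⟩
      exact ⟨_, (boundary_zero_apply _ label y E).symm⟩
  · obtain ⟨p, rfl⟩ := Submodule.mkQ_surjective _ x
    exact ⟨Finsupp.single E p, by simp⟩

end SimplicialChain

theorem mainTheorem1 {k σ V : Type*} [Field k] [Fintype V] [LinearOrder V]
    (Δ : AbstractSimplicialComplex V)
    (hΔ : Δ.toPreAbstractSimplicialComplex.IsTree)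
    (label : V → σ →₀ ℕ) :
    IsFreeResolution (MvPolynomial σ k)
        (Δ.toPreAbstractSimplicialComplex.ChainModule k σ)
        (Δ.toPreAbstractSimplicialComplex.boundary k label)
        (MvPolynomial σ k ⧸ labelIdeal k label) ↔
      ∀ m : σ →₀ ℕ, (Δ.toPreAbstractSimplicialComplex.inducedLE label m).IsConnected := by
  constructor
  · rintro ⟨-, hexact, -⟩ m
    exact SimplicialChain.isConnected_of_exactAt_one
      ((SimplicialChain.exact_boundary_iff _ label 0).1 (hexact 0) m)
  · intro hconn
    refine ⟨fun n => inferInstance, fun n => ?_, SimplicialChain.exists_augmentation Δ label⟩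
    refine (SimplicialChain.exact_boundary_iff _ label n).2 fun m => ?_
    -- Exactness at homological degree `n + 1` concerns faces of dimension `n`, so only `n = 0`
    -- calls on connectedness.
    cases n with
    | zero => exact SimplicialChain.exactAt_one_of_isConnected (hconn m)
    | succ n => exact SimplicialChain.exactAt_induced_of_isTree hΔ _ n
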